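/- Let $\lambda>3$ and let $\mu_\lambda$ be the Pareto probability measure on $[1,\infty)$ with density $(\lambda-1)x^{-\lambda}$. Let $n\ge 2$ and let $A=(A_{ij})_{1\le i,j\le n}$ be a real symmetric random matrix whose upper-triangular entries $A_{ij}$, $i\le j$ (diagonal included), are i.i.d. with law $\mu_\lambda$. Let $\lambda_1\ge\lambda_2\ge\dots\ge\lambda_n$ be the eigenvalues of $A$, counted with multiplicity. Then, for every $1\le i\le n$, $\lambda_i$ is square-integrable and $$\operatorname{Var}(\lambda_i)\le 2\,C(\lambda)\left(\frac{n(n-1)}{2}\right)^{\frac{2}{\lambda-1}},$$ where $$C(\lambda)=2^{\frac{6\lambda-16}{\lambda-1}}\,(\lambda-1)^{-\frac{2\lambda-6}{\lambda}}\left(\frac{4}{\lambda-3}\right)^{\frac{2}{\lambda-1}}.$$ -/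

import Mathlib

open MeasureTheory ProbabilityTheory

noncomputable section

/-- The Pareto law on `[1, ∞)` with density `(lam - 1) x ^ (-lam)`. -/
def paretoLaw (lam : ℝ) : Measure ℝ := paretoMeasure 1 (lam - 1)

/-- The constant `C(lam)`. -/
def paretoConst (lam : ℝ) : ℝ :=
  (2 : ℝ) ^ ((6 * lam - 16) / (lam - 1)) * (lam - 1) ^ (-((2 * lam - 6) / lam)) *
    (4 / (lam - 3)) ^ (2 / (lam - 1))

theorem isHermitian_of_isSymm {n : ℕ} {A : Matrix (Fin n) (Fin n) ℝ} (hA : A.IsSymm) :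
    A.IsHermitian := by
  rw [Matrix.IsHermitian, Matrix.conjTranspose_eq_transpose_of_trivial]
  exact hA

/-- The eigenvalues of a real symmetric matrix, counted with multiplicity and listed in
decreasing order. -/
def orderedEigenvalue {n : ℕ} (A : Matrix (Fin n) (Fin n) ℝ) (hA : A.IsSymm) (i : Fin n) : ℝ :=
  (isHermitian_of_isSymm hA).eigenvalues₀ (Fin.cast (Fintype.card_fin n).symm i)

theorem orderedEigenvalue_antitone {n : ℕ} (A : Matrix (Fin n) (Fin n) ℝ) (hA : A.IsSymm) :
    Antitone (orderedEigenvalue A hA) :=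
  fun _ _ hij => (isHermitian_of_isSymm hA).eigenvalues₀_antitone hij

theorem paretoLaw_eq_withDensity (lam : ℝ) :
    paretoLaw lam = (volume.restrict (Set.Ici 1)).withDensity
      (fun x => ENNReal.ofReal ((lam - 1) * x ^ (-lam))) := by
  rw [← withDensity_indicator measurableSet_Ici, paretoLaw, paretoMeasure]
  congr 1
  funext x
  by_cases hx : 1 ≤ x
  · simp [paretoPDF, paretoPDFReal, hx, Set.indicator]
  · simp [paretoPDF, paretoPDFReal, hx, Set.indicator]

end

/-! An ordered eigenvalue is a √2-Lipschitz function of the entries on and above the diagonal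
(Euclidean norm): Weyl's principle bounds its change by the Frobenius norm, which counts each
off-diagonal entry twice. So the theorem reduces to a variance bound for Lipschitz functions of `m`
independent Pareto variables, `variance_lipschitz_pareto_le`.

That bound starts from the weighted Poincaré inequality `variance_paretoLaw_le`, with weight `x ^ 2`
and constant `4 / (lam - 1) ^ 2`, tensorized through Efron–Stein in `variance_pi_le_sum_integral`.
For a smooth `K`-Lipschitz function the squared partials sum to at most `K ^ 2`. Cutting the weights
at a level `s` then costs `K ^ 2 * s ^ 2` plus the expected excesses over `s ^ 2`; the choice `s = m
^ (1 / (lam - 1))` makes both of order `m ^ (2 / (lam - 1))`. Mollification removes smoothness.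

The resulting constant, with `m = n(n+1)/2 ≤ 3 · n(n-1)/2`, is compared with `paretoConst` by taking
logarithms (`log_inequality`). -/

section Auxiliary

open scoped InnerProductSpace NNReal
open Set Filter Topology

/-! ### Weyl monotonicity of ordered eigenvalues -/

section Weyl

theorem OrthonormalBasis.norm_sq_eq_sum_inner_sq {E : Type*}
    [NormedAddCommGroup E] [InnerProductSpace ℝ E] {n : ℕ} (b : OrthonormalBasis (Fin n) ℝ E)
    (x : E) : ‖x‖ ^ 2 = ∑ j, ⟪b j, x⟫_ℝ ^ 2 := by
  rw [← real_inner_self_eq_norm_sq, ← b.sum_inner_mul_inner x x]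
  refine Finset.sum_congr rfl fun j _ => ?_
  rw [real_inner_comm x (b j), sq, real_inner_comm]

variable {E : Type*} [NormedAddCommGroup E] [InnerProductSpace ℝ E] [FiniteDimensional ℝ E]

theorem LinearMap.IsSymmetric.inner_apply_self_eq_sum {T : E →ₗ[ℝ] E} (hT : T.IsSymmetric)
    {n : ℕ} (hn : Module.finrank ℝ E = n) (x : E) :
    ⟪T x, x⟫_ℝ = ∑ j, hT.eigenvalues hn j * ⟪hT.eigenvectorBasis hn j, x⟫_ℝ ^ 2 := by
  rw [← (hT.eigenvectorBasis hn).sum_inner_mul_inner (T x) x]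
  refine Finset.sum_congr rfl fun j _ => ?_
  have h : ⟪T x, hT.eigenvectorBasis hn j⟫_ℝ
      = hT.eigenvalues hn j * ⟪hT.eigenvectorBasis hn j, x⟫_ℝ := by
    rw [hT, hT.apply_eigenvectorBasis, real_inner_comm]
    simp [inner_smul_left]
  rw [h]
  ring

/-- **Weyl's monotonicity principle** for the ordered eigenvalues. -/
theorem LinearMap.IsSymmetric.eigenvalues_le_add {T S : E →ₗ[ℝ] E} (hT : T.IsSymmetric)
    (hS : S.IsSymmetric) {n : ℕ} (hn : Module.finrank ℝ E = n) {c : ℝ}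
    (h : ∀ x, ⟪T x, x⟫_ℝ ≤ ⟪S x, x⟫_ℝ + c * ‖x‖ ^ 2) (i : Fin n) :
    hT.eigenvalues hn i ≤ hS.eigenvalues hn i + c := by
  -- Only `n - 1` linear conditions, so some nonzero `x` is orthogonal to the eigenvectors of `T`
  -- after `i` and to those of `S` before `i`; the quadratic forms at `x` then separate the two
  -- eigenvalues.
  let φ : E →ₗ[ℝ] ({j : Fin n // j ≠ i} → ℝ) := LinearMap.pi fun j =>
    if i < j.1 then innerₗ E (hT.eigenvectorBasis hn j.1)
    else innerₗ E (hS.eigenvectorBasis hn j.1)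
  have hlt : Module.finrank ℝ ({j : Fin n // j ≠ i} → ℝ) < Module.finrank ℝ E := by
    rw [Module.finrank_fintype_fun_eq_card, hn]
    simpa using Fintype.card_subtype_lt (p := fun j : Fin n => j ≠ i) (x := i) (by simp)
  obtain ⟨x, hx, hx0⟩ := Submodule.exists_mem_ne_zero_of_ne_bot
    (LinearMap.ker_ne_bot_of_finrank_lt (f := φ) hlt)
  have hφ : ∀ j (hj : j ≠ i), φ x ⟨j, hj⟩ = 0 := fun j hj => by
    rw [LinearMap.mem_ker.1 hx]; rfl
  have hTx : ∀ j, i < j → ⟪hT.eigenvectorBasis hn j, x⟫_ℝ = 0 := fun j hj => by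
    simpa [φ, hj] using hφ j hj.ne'
  have hSx : ∀ j, j < i → ⟪hS.eigenvectorBasis hn j, x⟫_ℝ = 0 := fun j hj => by
    simpa [φ, hj.le, not_lt.2 hj.le] using hφ j hj.ne
  have h1 : hT.eigenvalues hn i * ‖x‖ ^ 2 ≤ ⟪T x, x⟫_ℝ := by
    rw [hT.inner_apply_self_eq_sum hn, (hT.eigenvectorBasis hn).norm_sq_eq_sum_inner_sq,
      Finset.mul_sum]
    refine Finset.sum_le_sum fun j _ => ?_
    rcases lt_or_ge i j with hj | hj
    · simp [hTx j hj]
    · exact mul_le_mul_of_nonneg_right (hT.eigenvalues_antitone hn hj) (sq_nonneg _)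
  have h2 : ⟪S x, x⟫_ℝ ≤ hS.eigenvalues hn i * ‖x‖ ^ 2 := by
    rw [hS.inner_apply_self_eq_sum hn, (hS.eigenvectorBasis hn).norm_sq_eq_sum_inner_sq,
      Finset.mul_sum]
    refine Finset.sum_le_sum fun j _ => ?_
    rcases lt_or_ge j i with hj | hj
    · simp [hSx j hj]
    · exact mul_le_mul_of_nonneg_right (hS.eigenvalues_antitone hn hj) (sq_nonneg _)
  have h3 : 0 < ‖x‖ ^ 2 := by positivity
  nlinarith [h x]

end Weyl

/-! ### Eigenvalues as Lipschitz functions of the upper-triangular entries -/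

section Frobenius

variable {n : ℕ}

/-- Cauchy–Schwarz for the entries of `D` against those of `x xᵀ`, whose Frobenius norm is `‖x‖ ^
2`. -/
theorem Matrix.inner_toEuclideanLin_self_le (D : Matrix (Fin n) (Fin n) ℝ)
    (x : EuclideanSpace ℝ (Fin n)) :
    ⟪D.toEuclideanLin x, x⟫_ℝ ≤ √(∑ p : Fin n × Fin n, D p.1 p.2 ^ 2) * ‖x‖ ^ 2 := by
  have h1 : ⟪D.toEuclideanLin x, x⟫_ℝ = ∑ p : Fin n × Fin n, D p.1 p.2 * (x p.1 * x p.2) := by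
    rw [Fintype.sum_prod_type]
    simp only [PiLp.inner_apply, Matrix.toLpLin_apply, Matrix.mulVec, dotProduct]
    refine Finset.sum_congr rfl fun i _ => ?_
    simp only [RCLike.inner_apply, conj_trivial, Finset.mul_sum]
    exact Finset.sum_congr rfl fun j _ => by ring
  have h2 : ∑ p : Fin n × Fin n, (x p.1 * x p.2) ^ 2 = (‖x‖ ^ 2) ^ 2 := by
    rw [Fintype.sum_prod_type, EuclideanSpace.real_norm_sq_eq, sq (∑ i, x i ^ 2),
      Finset.sum_mul_sum]
    simp only [mul_pow]
  rw [h1]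
  refine (Real.sum_mul_le_sqrt_mul_sqrt _ _ _).trans ?_
  rw [h2, Real.sqrt_sq (by positivity)]

theorem orderedEigenvalue_le_add (A B : Matrix (Fin n) (Fin n) ℝ) (hA : A.IsSymm) (hB : B.IsSymm)
    (i : Fin n) :
    orderedEigenvalue A hA i ≤
      orderedEigenvalue B hB i + √(∑ p : Fin n × Fin n, (A p.1 p.2 - B p.1 p.2) ^ 2) := by
  refine LinearMap.IsSymmetric.eigenvalues_le_add _ _ _ (fun x => ?_) _
  have := (A - B).inner_toEuclideanLin_self_le x
  rw [map_sub, LinearMap.sub_apply, inner_sub_left] at this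
  simp only [Matrix.sub_apply] at this
  linarith

/-- The symmetric matrix with prescribed entries on and above the diagonal. -/
def symmetricOfUpper (x : {p : Fin n × Fin n // p.1 ≤ p.2} → ℝ) : Matrix (Fin n) (Fin n) ℝ :=
  Matrix.of fun i j => x ⟨(i ⊓ j, i ⊔ j), inf_le_sup⟩

theorem symmetricOfUpper_isSymm (x : {p : Fin n × Fin n // p.1 ≤ p.2} → ℝ) :
    (symmetricOfUpper x).IsSymm := by
  ext i j
  simp only [symmetricOfUpper, Matrix.transpose_apply, Matrix.of_apply, inf_comm, sup_comm]

theorem symmetricOfUpper_entries {A : Matrix (Fin n) (Fin n) ℝ} (hA : A.IsSymm) :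
    symmetricOfUpper (fun e => A e.1.1 e.1.2) = A := by
  ext i j
  rcases le_total i j with h | h
  · simp [symmetricOfUpper, h]
  · simp [symmetricOfUpper, h, hA.apply]

theorem sum_inf_sup_le_two_mul (d : {p : Fin n × Fin n // p.1 ≤ p.2} → ℝ) (hd : ∀ e, 0 ≤ d e) :
    ∑ p : Fin n × Fin n, d ⟨(p.1 ⊓ p.2, p.1 ⊔ p.2), inf_le_sup⟩ ≤ 2 * ∑ e, d e := by
  classical
  -- Extension of `d` by zero below the diagonal. Each summand is at most `g p + g p.swap`; only
  -- diagonal terms are overcounted.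
  let g : Fin n × Fin n → ℝ := fun p => if h : p.1 ≤ p.2 then d ⟨p, h⟩ else 0
  have hg0 : ∀ p, 0 ≤ g p := fun p => by
    dsimp only [g]; split_ifs with h
    exacts [hd _, le_rfl]
  have hg : ∑ p, g p = ∑ e, d e := by
    rw [← Finset.sum_filter_add_sum_filter_not Finset.univ
      (fun p : Fin n × Fin n => p.1 ≤ p.2)]
    rw [Finset.sum_eq_zero (s := Finset.univ.filter fun p : Fin n × Fin n => ¬ p.1 ≤ p.2)
      (fun p hp => dif_neg (Finset.mem_filter.1 hp).2), add_zero,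
      Finset.sum_subtype (p := fun p : Fin n × Fin n => p.1 ≤ p.2) _ (by simp)]
    exact Finset.sum_congr rfl fun e _ => dif_pos e.2
  have hswap : ∑ p : Fin n × Fin n, g p.swap = ∑ e, d e := by
    rw [← hg]; exact (Equiv.prodComm (Fin n) (Fin n)).sum_comp g
  rw [two_mul]
  nth_rewrite 1 [← hg]
  rw [← hswap, ← Finset.sum_add_distrib]
  refine Finset.sum_le_sum fun p _ => ?_
  rcases le_total p.1 p.2 with h | h
  · have : g p = d ⟨(p.1 ⊓ p.2, p.1 ⊔ p.2), inf_le_sup⟩ := by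
      simp [g, h]
    linarith [hg0 p.swap]
  · have : g p.swap = d ⟨(p.1 ⊓ p.2, p.1 ⊔ p.2), inf_le_sup⟩ := by
      simp [g, h, Prod.swap]
    linarith [hg0 p]

theorem lipschitzWith_orderedEigenvalue_symmetricOfUpper (i : Fin n) :
    LipschitzWith (NNReal.sqrt 2)
      (fun x : EuclideanSpace ℝ {p : Fin n × Fin n // p.1 ≤ p.2} =>
        orderedEigenvalue (symmetricOfUpper x) (symmetricOfUpper_isSymm x) i) := by
  refine LipschitzWith.of_le_add_mul _ fun x y => ?_
  refine (orderedEigenvalue_le_add _ _ _ (symmetricOfUpper_isSymm y) i).trans ?_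
  gcongr
  rw [EuclideanSpace.dist_eq, Real.coe_sqrt, ← Real.sqrt_mul (by simp)]
  refine Real.sqrt_le_sqrt ?_
  simp only [Real.dist_eq, sq_abs]
  exact sum_inf_sup_le_two_mul (fun e => (x e - y e) ^ 2) (fun e => sq_nonneg _)

end Frobenius

/-! ### Efron–Stein inequality for two factors -/

section EfronStein

variable {α β : Type*} [MeasurableSpace α] [MeasurableSpace β] {μ : Measure α} {ν : Measure β}
  [IsProbabilityMeasure μ] [IsProbabilityMeasure ν]

theorem sq_integral_le_integral_sq {h : β → ℝ} (hh : MemLp h 2 ν) :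
    (∫ y, h y ∂ν) ^ 2 ≤ ∫ y, h y ^ 2 ∂ν := by
  have := variance_nonneg h ν
  rw [variance_eq_sub hh] at this
  simpa using this

theorem ae_memLp_two_prod_right {F : α × β → ℝ} (hF : MemLp F 2 (μ.prod ν)) :
    ∀ᵐ x ∂μ, MemLp (fun y => F (x, y)) 2 ν := by
  filter_upwards [hF.1.prodMk_left, hF.integrable_sq.prod_right_ae] with x h1 h2
  exact (memLp_two_iff_integrable_sq h1).2 h2

theorem memLp_two_integral_prod_left {F : α × β → ℝ} (hF : MemLp F 2 (μ.prod ν)) :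
    MemLp (fun x => ∫ y, F (x, y) ∂ν) 2 μ := by
  have hm : AEStronglyMeasurable (fun x => ∫ y, F (x, y) ∂ν) μ := hF.1.integral_prod_right'
  refine (memLp_two_iff_integrable_sq hm).2 ?_
  refine hF.integrable_sq.integral_prod_left.mono' (hm.pow 2) ?_
  filter_upwards [ae_memLp_two_prod_right hF] with x hx
  rw [Real.norm_of_nonneg (sq_nonneg _)]
  exact sq_integral_le_integral_sq hx

theorem integral_variance_prod_right {F : α × β → ℝ} (hF : MemLp F 2 (μ.prod ν)) :
    ∫ x, Var[fun y => F (x, y); ν] ∂μ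
      = ∫ z, F z ^ 2 ∂(μ.prod ν) - ∫ x, (∫ y, F (x, y) ∂ν) ^ 2 ∂μ := by
  rw [integral_prod _ hF.integrable_sq, ← integral_sub hF.integrable_sq.integral_prod_left
    (memLp_two_integral_prod_left hF).integrable_sq]
  refine integral_congr_ae ?_
  filter_upwards [ae_memLp_two_prod_right hF] with x hx
  rw [variance_eq_sub hx]
  rfl

theorem integral_mul_integral_prod_right {F : α × β → ℝ} (hF : MemLp F 2 (μ.prod ν)) :
    ∫ z, F z * (∫ y, F (z.1, y) ∂ν) ∂(μ.prod ν) = ∫ x, (∫ y, F (x, y) ∂ν) ^ 2 ∂μ := by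
  have hG : MemLp (fun z : α × β => ∫ y, F (z.1, y) ∂ν) 2 (μ.prod ν) :=
    (memLp_two_integral_prod_left hF).comp_fst ν
  have hFG : Integrable (fun z : α × β => F z * ∫ y, F (z.1, y) ∂ν) (μ.prod ν) :=
    hF.integrable_mul hG
  rw [integral_prod _ hFG]
  refine integral_congr_ae (ae_of_all _ fun x => ?_)
  simp only [integral_mul_const, sq]

/-- The **Efron–Stein inequality** for two independent factors. -/
theorem variance_prod_le_add {F : α × β → ℝ} (hF : MemLp F 2 (μ.prod ν)) :
    Var[F; μ.prod ν] ≤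
      ∫ x, Var[fun y => F (x, y); ν] ∂μ + ∫ y, Var[fun x => F (x, y); μ] ∂ν := by
  have hF' : MemLp (fun z : β × α => F z.swap) 2 (ν.prod μ) :=
    hF.comp_measurePreserving Measure.measurePreserving_swap
  have hG := memLp_two_integral_prod_left hF
  have hH : MemLp (fun y => ∫ x, F (x, y) ∂μ) 2 ν := memLp_two_integral_prod_left hF'
  have hV2 := integral_variance_prod_right hF'
  have hswap : ∀ f : α × β → ℝ, ∫ z, f z.swap ∂(ν.prod μ) = ∫ z, f z ∂(μ.prod ν) :=
    fun f => integral_prod_swap f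
  have hFH : ∫ z, F z * (∫ x, F (x, z.2) ∂μ) ∂(μ.prod ν) = ∫ y, (∫ x, F (x, y) ∂μ) ^ 2 ∂ν := by
    rw [← hswap]
    exact integral_mul_integral_prod_right hF'
  have hsq : ∫ z, F z.swap ^ 2 ∂(ν.prod μ) = ∫ z, F z ^ 2 ∂(μ.prod ν) := hswap fun z => F z ^ 2
  have hFG := integral_mul_integral_prod_right hF
  simp only [Prod.swap_prod_mk] at hV2
  rw [integral_variance_prod_right hF, hV2, hsq, variance_eq_sub hF]
  set G : α → ℝ := fun x => ∫ y, F (x, y) ∂ν with hGdef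
  set H : β → ℝ := fun y => ∫ x, F (x, y) ∂μ with hHdef
  set m : ℝ := ∫ z, F z ∂(μ.prod ν) with hm
  have hGm : ∫ x, G x ∂μ = m := (integral_prod _ (hF.integrable one_le_two)).symm
  have hHm : ∫ y, H y ∂ν = m := (integral_prod_symm _ (hF.integrable one_le_two)).symm
  have hG1 : MemLp (fun z : α × β => G z.1) 2 (μ.prod ν) := hG.comp_fst ν
  have hH1 : MemLp (fun z : α × β => H z.2) 2 (μ.prod ν) := hH.comp_snd μ
  have iGG : ∫ z, G z.1 ^ 2 ∂(μ.prod ν) = ∫ x, G x ^ 2 ∂μ := by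
    simpa using integral_fun_fst (μ := μ) (ν := ν) fun x => G x ^ 2
  have iHH : ∫ z, H z.2 ^ 2 ∂(μ.prod ν) = ∫ y, H y ^ 2 ∂ν := by
    simpa using integral_fun_snd (μ := μ) (ν := ν) fun y => H y ^ 2
  have iGH : ∫ z, G z.1 * H z.2 ∂(μ.prod ν) = m * m := by
    rw [integral_prod_mul, hGm, hHm]
  -- The whole inequality is the nonnegativity of the variance of the interaction term `F - G - H`,
  -- whose mean is `-m`.
  have hpos : 0 ≤ ∫ z, (F z - G z.1 - H z.2) ^ 2 ∂(μ.prod ν) - m ^ 2 := by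
    have h1 := sq_integral_le_integral_sq ((hF.sub hG1).sub hH1)
    have h2 : ∫ z, (F z - G z.1 - H z.2) ∂(μ.prod ν) = -m := by
      have hFG1 : Integrable (fun z : α × β => F z - G z.1) (μ.prod ν) :=
        (hF.sub hG1).integrable one_le_two
      rw [integral_sub hFG1 (hH1.integrable one_le_two),
        integral_sub (hF.integrable one_le_two) (hG1.integrable one_le_two)]
      have e1 : ∫ z, G z.1 ∂(μ.prod ν) = m := by
        simpa [hGm] using integral_fun_fst (μ := μ) (ν := ν) G
      have e2 : ∫ z, H z.2 ∂(μ.prod ν) = m := by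
        simpa [hHm] using integral_fun_snd (μ := μ) (ν := ν) H
      rw [e1, e2]; ring
    simp only [Pi.sub_apply] at h1
    rw [h2] at h1
    nlinarith
  have hexp : ∫ z, (F z - G z.1 - H z.2) ^ 2 ∂(μ.prod ν)
      = ∫ z, F z ^ 2 ∂(μ.prod ν) + ∫ x, G x ^ 2 ∂μ + ∫ y, H y ^ 2 ∂ν
        - 2 * ∫ x, G x ^ 2 ∂μ - 2 * ∫ y, H y ^ 2 ∂ν + 2 * (m * m) := by
    have hcongr : ∀ z : α × β, (F z - G z.1 - H z.2) ^ 2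
        = F z ^ 2 + G z.1 ^ 2 + H z.2 ^ 2 + (-2) * (F z * G z.1) + (-2) * (F z * H z.2)
          + 2 * (G z.1 * H z.2) := fun z => by ring
    have a1 := hF.integrable_sq
    have a2 := hG1.integrable_sq
    have a3 := hH1.integrable_sq
    have a4 : Integrable (fun z : α × β => (-2) * (F z * G z.1)) (μ.prod ν) :=
      (hF.integrable_mul hG1).const_mul (-2)
    have a5 : Integrable (fun z : α × β => (-2) * (F z * H z.2)) (μ.prod ν) :=
      (hF.integrable_mul hH1).const_mul (-2)
    have a6 : Integrable (fun z : α × β => 2 * (G z.1 * H z.2)) (μ.prod ν) :=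
      (hG1.integrable_mul hH1).const_mul 2
    simp_rw [hcongr]
    rw [integral_add (((((a1.fun_add a2).fun_add a3).fun_add a4).fun_add a5)) a6,
      integral_add (((a1.fun_add a2).fun_add a3).fun_add a4) a5,
      integral_add ((a1.fun_add a2).fun_add a3) a4,
      integral_add (a1.fun_add a2) a3, integral_add a1 a2, integral_const_mul, integral_const_mul,
      integral_const_mul, iGG, iHH, iGH, hFG, hFH]
    ring
  change ∫ z, F z ^ 2 ∂(μ.prod ν) - m ^ 2 ≤ _
  linarith

end EfronStein

/-! ### Tensorization of the weighted Poincaré inequality -/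

section Tensorization

theorem LipschitzWith.memLp_comp {Ω E F : Type*} [MeasurableSpace Ω] {P : Measure Ω}
    [IsFiniteMeasure P] [NormedAddCommGroup E] [NormedAddCommGroup F] {p : ENNReal} {X : Ω → E}
    (hX : MemLp X p P) {f : E → F} {K : ℝ≥0} (hf : LipschitzWith K f) :
    MemLp (fun ω => f (X ω)) p P := by
  have h : LipschitzWith K fun x => f x - f 0 :=
    LipschitzWith.of_dist_le_mul fun x y => by simpa using hf.dist_le_mul x y
  have h2 := (h.comp_memLp (by simp) hX).add (memLp_const (μ := P) (f 0))
  refine h2.congr_norm ?_ (ae_of_all _ fun ω => by simp)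
  exact hf.continuous.comp_aestronglyMeasurable hX.1

theorem HasDerivAt.abs_le_of_lipschitzWith {g : ℝ → ℝ} {g' x : ℝ} {K : ℝ≥0}
    (hg : HasDerivAt g g' x) (hK : LipschitzWith K g) : |g'| ≤ K := by
  have := hg.hasFDerivAt.le_of_lipschitz hK
  simpa using this

theorem memLp_pi_eval {μ : Measure ℝ} [IsProbabilityMeasure μ] {ι : Type*} [Fintype ι]
    {p : ENNReal} (hμ : MemLp id p μ) (i : ι) :
    MemLp (fun x : ι → ℝ => x i) p (Measure.pi fun _ => μ) :=
  hμ.comp_measurePreserving (measurePreserving_eval (fun _ : ι => μ) i)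

theorem lipschitzWith_update {ι : Type*} [Fintype ι] [DecidableEq ι] (x : ι → ℝ) (i : ι) :
    LipschitzWith 1 (fun t => Function.update x i t) := by
  refine LipschitzWith.of_dist_le_mul fun s t => ?_
  rw [NNReal.coe_one, one_mul]
  refine (dist_pi_le_iff dist_nonneg).2 fun j => ?_
  rcases eq_or_ne j i with rfl | h
  · simp
  · simp [h]

theorem integrable_sq_mul_sq_pi {μ : Measure ℝ} [IsProbabilityMeasure μ] (hμ : MemLp id 2 μ)
    {ι : Type*} [Fintype ι] {d : (ι → ℝ) → ℝ} (hd : Continuous d) {K : ℝ} (hK : ∀ x, |d x| ≤ K)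
    (c : ℝ) (i : ι) :
    Integrable (fun x : ι → ℝ => c * (x i ^ 2 * d x ^ 2)) (Measure.pi fun _ => μ) := by
  refine Integrable.const_mul ?_ c
  refine ((memLp_pi_eval hμ i).integrable_sq.mul_const (K ^ 2)).mono'
    (by fun_prop) (ae_of_all _ fun x => ?_)
  rw [Real.norm_of_nonneg (by positivity)]
  gcongr ?_ * ?_
  exact sq_le_sq' (abs_le.1 (hK x)).1 (abs_le.1 (hK x)).2

/-- Tensorization of the weighted Poincaré inequality `Var g ≤ c ∫ x ^ 2 * g' ^ 2`. -/
theorem variance_pi_le_sum_integral {μ : Measure ℝ} [IsProbabilityMeasure μ]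
    (hμ : MemLp id 2 μ) {c : ℝ}
    (h1 : ∀ (g g' : ℝ → ℝ) (K : ℝ≥0), LipschitzWith K g → Continuous g' →
      (∀ x, HasDerivAt g (g' x) x) → Var[g; μ] ≤ ∫ x, c * (x ^ 2 * g' x ^ 2) ∂μ) :
    ∀ (m : ℕ) (f : (Fin m → ℝ) → ℝ) (D : (Fin m → ℝ) → Fin m → ℝ) (K : ℝ≥0),
      LipschitzWith K f → (∀ i, Continuous fun x => D x i) →
      (∀ x i, HasDerivAt (fun t => f (Function.update x i t)) (D x i) (x i)) →
      Var[f; Measure.pi fun _ => μ]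
        ≤ ∑ i, ∫ x, c * (x i ^ 2 * D x i ^ 2) ∂(Measure.pi fun _ => μ) := by
  intro m
  induction m with
  | zero =>
    intro f D K _ _ _
    have : f = fun _ => f default := funext fun x => congrArg f (Subsingleton.elim _ _)
    rw [this, Finset.univ_eq_empty, Finset.sum_empty,
      variance_eq_integral measurable_const.aemeasurable]
    simp
  | succ m ih =>
    intro f D K hf hDc hD
    -- The Lipschitz constant enters only here: bounded partials and a finite second moment make all
    -- the integrands integrable.
    have hDK : ∀ i x, |D x i| ≤ K := fun i x => by
      refine (hD x i).abs_le_of_lipschitzWith ?_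
      simpa [Function.comp_def] using hf.comp (lipschitzWith_update x i)
    have hmp := (measurePreserving_piFinSuccAbove (fun _ : Fin (m + 1) => μ) 0).symm
    have he : ∀ z : ℝ × (Fin m → ℝ),
        (MeasurableEquiv.piFinSuccAbove (fun _ : Fin (m + 1) => ℝ) 0).symm z
          = Fin.cons z.1 z.2 := fun z => by
      simp [MeasurableEquiv.piFinSuccAbove, Fin.insertNthEquiv]
    have hfL : MemLp f 2 (Measure.pi fun _ => μ) :=
      LipschitzWith.memLp_comp (memLp_pi_iff.2 fun i => memLp_pi_eval hμ i) hf
    have hI : ∀ i, Integrable (fun x => c * (x i ^ 2 * D x i ^ 2)) (Measure.pi fun _ => μ) :=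
      fun i => integrable_sq_mul_sq_pi hμ (hDc i) (hDK i) c i
    have hFL := hfL.comp_measurePreserving hmp
    have hvar := hmp.variance_fun_comp hfL.aemeasurable
    simp only [Function.comp_def, he] at hFL hvar
    have hint : ∀ i, ∫ x, c * (x i ^ 2 * D x i ^ 2) ∂(Measure.pi fun _ => μ)
        = ∫ z : ℝ × (Fin m → ℝ), c * ((Fin.cons z.1 z.2 : Fin (m + 1) → ℝ) i ^ 2
          * D (Fin.cons z.1 z.2) i ^ 2) ∂(μ.prod (Measure.pi fun _ => μ)) := fun i => by
      have := hmp.integral_comp' fun x => c * (x i ^ 2 * D x i ^ 2)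
      simp only [he] at this
      exact this.symm
    have hI' : ∀ i, Integrable (fun z : ℝ × (Fin m → ℝ) =>
        c * ((Fin.cons z.1 z.2 : Fin (m + 1) → ℝ) i ^ 2 * D (Fin.cons z.1 z.2) i ^ 2))
        (μ.prod (Measure.pi fun _ => μ)) := fun i => by
      have := hmp.integrable_comp_of_integrable (hI i)
      simpa only [Function.comp_def, he] using this
    have hcx : ∀ x : ℝ, LipschitzWith 1 fun y : Fin m → ℝ => (Fin.cons x y : Fin (m + 1) → ℝ) :=
      fun x => LipschitzWith.of_dist_le_mul fun y y' => by
        rw [NNReal.coe_one, one_mul]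
        refine (dist_pi_le_iff dist_nonneg).2 fun j => ?_
        cases j using Fin.cases with
        | zero => simp
        | succ j => simpa using dist_le_pi_dist y y' j
    have hcy : ∀ y : Fin m → ℝ, LipschitzWith 1 fun x : ℝ => (Fin.cons x y : Fin (m + 1) → ℝ) :=
      fun y => by
        simpa only [Fin.update_cons_zero] using
          lipschitzWith_update (Fin.cons 0 y : Fin (m + 1) → ℝ) 0
    rw [← hvar, Fin.sum_univ_succ]
    -- Coordinate `0` is handled by `h1` with the others frozen, the remaining ones by the induction
    -- hypothesis.
    refine (variance_prod_le_add hFL).trans ((add_comm _ _).trans_le (add_le_add ?_ ?_))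
    · rw [hint, integral_prod_symm _ (hI' 0)]
      refine integral_mono_of_nonneg (ae_of_all _ fun y => variance_nonneg _ _)
        (hI' 0).integral_prod_right (ae_of_all _ fun y => ?_)
      refine h1 (fun x => f (Fin.cons x y)) (fun x => D (Fin.cons x y) 0) K
        (by simpa [Function.comp_def] using hf.comp (hcy y)) ((hDc 0).comp (hcy y).continuous) fun x => ?_
      simpa only [Fin.update_cons_zero, Fin.cons_zero] using hD (Fin.cons x y) 0
    · have hsum : ∀ x, Var[fun y : Fin m → ℝ => f (Fin.cons x y); Measure.pi fun _ => μ]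
          ≤ ∑ i : Fin m, ∫ y : Fin m → ℝ, c * (y i ^ 2 * D (Fin.cons x y) i.succ ^ 2)
            ∂(Measure.pi fun _ => μ) := fun x => by
        refine ih (fun y => f (Fin.cons x y)) (fun y i => D (Fin.cons x y) i.succ) K
          (by simpa [Function.comp_def] using hf.comp (hcx x)) (fun i => (hDc i.succ).comp (hcx x).continuous)
          fun y i => ?_
        simpa only [Fin.cons_update, Fin.cons_succ] using hD (Fin.cons x y) i.succ
      have hJ : ∀ i : Fin m, Integrable (fun x => ∫ y : Fin m → ℝ,
          c * (y i ^ 2 * D (Fin.cons x y) i.succ ^ 2) ∂(Measure.pi fun _ => μ)) μ := fun i => by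
        simpa only [Fin.cons_succ] using (hI' i.succ).integral_prod_left
      refine (integral_mono_of_nonneg (ae_of_all _ fun x => variance_nonneg _ _)
        (integrable_finsetSum _ fun i _ => hJ i) (ae_of_all _ hsum)).trans (le_of_eq ?_)
      rw [integral_finsetSum _ fun i _ => hJ i]
      refine Finset.sum_congr rfl fun i _ => ?_
      rw [hint, integral_prod _ (hI' i.succ)]
      simp only [Fin.cons_succ]

end Tensorization

/-! ### Moments and Hardy's inequality for the Pareto law -/

section Pareto

variable {lam : ℝ}

theorem isProbabilityMeasure_paretoLaw (hlam : 1 < lam) : IsProbabilityMeasure (paretoLaw lam) :=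
  isProbabilityMeasure_paretoMeasure one_pos (by linarith)

theorem integrable_paretoLaw_iff (hlam : 1 < lam) {h : ℝ → ℝ} :
    Integrable h (paretoLaw lam) ↔
      IntegrableOn (fun x => (lam - 1) * x ^ (-lam) * h x) (Ioi 1) := by
  rw [paretoLaw_eq_withDensity, integrable_withDensity_iff_integrable_smul' (by fun_prop)
    (ae_of_all _ fun _ => ENNReal.ofReal_lt_top), ← IntegrableOn, IntegrableOn,
    ← restrict_Ioi_eq_restrict_Ici, ← IntegrableOn]
  refine integrableOn_congr_fun (fun x hx => ?_) measurableSet_Ioi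
  have hx : 1 < x := hx
  rw [ENNReal.toReal_ofReal (mul_nonneg (by linarith) (by positivity)), smul_eq_mul]

theorem integral_paretoLaw (hlam : 1 < lam) (h : ℝ → ℝ) :
    ∫ x, h x ∂(paretoLaw lam) = ∫ x in Ioi 1, (lam - 1) * x ^ (-lam) * h x := by
  rw [paretoLaw_eq_withDensity, integral_withDensity_eq_integral_toReal_smul (by fun_prop)
    (ae_of_all _ fun _ => ENNReal.ofReal_lt_top), ← restrict_Ioi_eq_restrict_Ici]
  refine setIntegral_congr_fun measurableSet_Ioi fun x hx => ?_
  have hx : 1 < x := hx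
  rw [ENNReal.toReal_ofReal (mul_nonneg (by linarith) (by positivity)), smul_eq_mul]

theorem memLp_two_id_paretoLaw (hlam : 3 < lam) : MemLp id 2 (paretoLaw lam) := by
  refine (memLp_two_iff_integrable_sq (by fun_prop)).2 ?_
  rw [integrable_paretoLaw_iff (by linarith)]
  have h : IntegrableOn (fun x : ℝ => (lam - 1) * x ^ (2 - lam)) (Ioi 1) :=
    (integrableOn_Ioi_rpow_of_lt (a := 2 - lam) (by linarith) one_pos).const_mul _
  refine h.congr_fun (fun x hx => ?_) measurableSet_Ioi
  have hx : (0 : ℝ) < x := one_pos.trans hx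
  simp only [id]
  rw [sub_eq_add_neg 2 lam, Real.rpow_add hx, Real.rpow_two]
  ring

theorem integral_max_sq_sub_paretoLaw (hlam : 3 < lam) {s : ℝ} (hs : 1 ≤ s) :
    ∫ x, max (x ^ 2 - s ^ 2) 0 ∂(paretoLaw lam) = 2 / (lam - 3) * s ^ (3 - lam) := by
  have hs0 : 0 < s := by linarith
  rw [integral_paretoLaw (by linarith),
    setIntegral_eq_of_subset_of_forall_sdiff_eq_zero measurableSet_Ioi
      (Ioi_subset_Ioi hs) (fun x hx => ?_)]
  · have hcongr : EqOn (fun x : ℝ => (lam - 1) * x ^ (-lam) * max (x ^ 2 - s ^ 2) 0)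
        (fun x => (lam - 1) * x ^ (2 - lam) - (lam - 1) * s ^ 2 * x ^ (-lam)) (Ioi s) := by
      intro x hx
      have hx : s < x := hx
      simp only
      rw [max_eq_left (by nlinarith), sub_eq_add_neg 2 lam, Real.rpow_add (by linarith),
        Real.rpow_two]
      ring
    rw [setIntegral_congr_fun measurableSet_Ioi hcongr, integral_sub
      ((integrableOn_Ioi_rpow_of_lt (by linarith) hs0).const_mul _)
      ((integrableOn_Ioi_rpow_of_lt (by linarith) hs0).const_mul _),
      integral_const_mul, integral_const_mul, integral_Ioi_rpow_of_lt (by linarith) hs0,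
      integral_Ioi_rpow_of_lt (by linarith) hs0]
    have e1 : s ^ (2 - lam + 1) = s ^ (3 - lam) := by congr 1; ring
    have e2 : s ^ (-lam + 1) * s ^ 2 = s ^ (3 - lam) := by
      rw [← Real.rpow_two, ← Real.rpow_add hs0]; congr 1; ring
    have h3 : lam - 3 ≠ 0 := by linarith
    have h1 : lam - 1 ≠ 0 := by linarith
    have h3' : 2 - lam + 1 = -(lam - 3) := by ring
    have h1' : -lam + 1 = -(lam - 1) := by ring
    rw [e1, h3', h1', ← e2, h1']
    field_simp
    ring
  · obtain ⟨hx1, hx2⟩ := hx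
    have hx1 : 1 < x := hx1
    have hx2 : x ≤ s := not_lt.1 hx2
    rw [max_eq_right (by nlinarith), mul_zero]

/-- The weighted Poincaré inequality for the Pareto law, a form of Hardy's inequality. -/
theorem variance_paretoLaw_le (hlam : 3 < lam) {g g' : ℝ → ℝ} {K : ℝ≥0}
    (hg : LipschitzWith K g) (hg'c : Continuous g') (hg' : ∀ x, HasDerivAt g (g' x) x) :
    Var[g; paretoLaw lam] ≤ ∫ x, 4 / (lam - 1) ^ 2 * (x ^ 2 * g' x ^ 2) ∂(paretoLaw lam) := by
  have hP := isProbabilityMeasure_paretoLaw (lam := lam) (by linarith)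
  -- Centring at `g 1` instead of the mean kills the boundary term at `1`.
  set h : ℝ → ℝ := fun x => g x - g 1 with hh
  have hid := memLp_two_id_paretoLaw hlam
  have hL : MemLp h 2 (paretoLaw lam) :=
    (LipschitzWith.memLp_comp hid hg).sub (memLp_const _)
  have hpL : MemLp (fun x => x * g' x) 2 (paretoLaw lam) := by
    refine (hid.const_mul (K : ℝ)).mono (by fun_prop) (ae_of_all _ fun x => ?_)
    have := (hg' x).abs_le_of_lipschitzWith hg
    simp only [id, norm_mul, Real.norm_eq_abs, NNReal.abs_eq]
    rw [mul_comm]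
    gcongr
  have hvar : Var[g; paretoLaw lam] ≤ ∫ x, h x ^ 2 ∂(paretoLaw lam) := by
    rw [← variance_sub_const hg.continuous.aestronglyMeasurable (g 1)]
    exact variance_le_expectation_sq hL.1
  have i1 := hL.integrable_sq
  have i2 : Integrable (fun x => (x * g' x) ^ 2) (paretoLaw lam) := hpL.integrable_sq
  have i3 : Integrable (fun x => h x * (x * g' x)) (paretoLaw lam) := hL.integrable_mul hpL
  have iG : Integrable (fun x => 2 / (lam - 1) * (h x * (x * g' x)) - h x ^ 2) (paretoLaw lam) :=
    (i3.const_mul _).sub i1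
  have hl1 : lam - 1 ≠ 0 := by linarith
  -- Integration by parts: against the density, this is the derivative of `h ^ 2 * x ^ (1 - lam)`,
  -- which vanishes at infinity since `|h x| ≤ K * x` and `lam > 3`.
  have hG : ∫ x, (2 / (lam - 1) * (h x * (x * g' x)) - h x ^ 2) ∂(paretoLaw lam) = 0 := by
    rw [integral_paretoLaw (by linarith)]
    have hd : ∀ x ∈ Ici (1 : ℝ), HasDerivAt (fun x => h x ^ 2 * x ^ (1 - lam))
        ((lam - 1) * x ^ (-lam) * (2 / (lam - 1) * (h x * (x * g' x)) - h x ^ 2)) x := by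
      intro x hx
      have hx0 : 0 < x := lt_of_lt_of_le one_pos hx
      have hxh : HasDerivAt h (g' x) x := (hg' x).sub_const _
      convert! (hxh.pow 2).mul (Real.hasDerivAt_rpow_const (p := 1 - lam) (Or.inl hx0.ne')) using 1
      have e1 : x ^ (1 - lam) = x * x ^ (-lam) := by
        rw [sub_eq_add_neg, Real.rpow_add hx0, Real.rpow_one]
      have e2 : x ^ (1 - lam - 1) = x ^ (-lam) := by congr 1; ring
      rw [e1, e2]
      simp only [Nat.cast_ofNat, Pi.pow_apply]
      field_simp
      ring
    have ht : Tendsto (fun x => h x ^ 2 * x ^ (1 - lam)) atTop (𝓝 0) := by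
      have h0 : Tendsto (fun x : ℝ => (K : ℝ) ^ 2 * x ^ (-(lam - 3))) atTop (𝓝 0) := by
        simpa using (tendsto_rpow_neg_atTop (by linarith : 0 < lam - 3)).const_mul ((K : ℝ) ^ 2)
      refine squeeze_zero' ?_ ?_ h0
      · filter_upwards [eventually_ge_atTop 1] with x hx
        positivity
      · filter_upwards [eventually_ge_atTop 1] with x hx
        have hx0 : 0 < x := by linarith
        have hb : |h x| ≤ K * x := by
          have := hg.dist_le_mul x 1
          rw [Real.dist_eq, Real.dist_eq, abs_of_nonneg (by linarith : 0 ≤ x - 1)] at this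
          exact this.trans (by gcongr; linarith)
        have e1 : x ^ (-(lam - 3)) = x ^ 2 * x ^ (1 - lam) := by
          rw [← Real.rpow_two, ← Real.rpow_add hx0]; congr 1; ring
        rw [e1, ← mul_assoc, ← mul_pow, ← sq_abs (h x)]
        gcongr
    rw [integral_Ioi_of_hasDerivAt_of_tendsto' hd
      ((integrable_paretoLaw_iff (by linarith)).1 iG) ht]
    simp [hh]
  have hmono : ∫ x, h x ^ 2 ∂(paretoLaw lam) ≤ ∫ x, (4 / (lam - 1) ^ 2 * (x * g' x) ^ 2
      - 2 * (2 / (lam - 1) * (h x * (x * g' x)) - h x ^ 2)) ∂(paretoLaw lam) := by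
    refine integral_mono i1 ((i2.const_mul _).sub (iG.const_mul 2)) fun x => ?_
    -- Completing the square; twice the null integrand of `hG` absorbs the cross term.
    have : 0 ≤ (2 / (lam - 1) * (x * g' x) - h x) ^ 2 := sq_nonneg _
    have e : (4 : ℝ) / (lam - 1) ^ 2 = (2 / (lam - 1)) ^ 2 := by rw [div_pow]; norm_num
    simp only
    rw [e]
    linarith
  rw [integral_sub (i2.const_mul _) (iG.const_mul 2), integral_const_mul 2, hG] at hmono
  simp only [mul_zero, sub_zero, mul_pow] at hmono
  exact hvar.trans hmono

end Pareto

/-! ### Smoothing Lipschitz functions and passing to the limit in the variance -/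

section Mollification

open scoped Convolution

/-- Lipschitz functions are uniform limits of smooth functions with the same Lipschitz constant. -/
theorem LipschitzWith.exists_contDiff_dist_le {E : Type*} [NormedAddCommGroup E]
    [InnerProductSpace ℝ E] [FiniteDimensional ℝ E] {f : E → ℝ} {K : ℝ≥0} (hf : LipschitzWith K f)
    {ε : ℝ} (hε : 0 < ε) :
    ∃ g : E → ℝ, ContDiff ℝ 1 g ∧ LipschitzWith K g ∧ ∀ x, dist (g x) (f x) ≤ K * ε := by
  borelize E
  -- Averaging translates of `f` against a probability density keeps the constant `K`; support of
  -- radius `ε` gives the error `K * ε`.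
  let φ : ContDiffBump (0 : E) := ⟨ε / 2, ε, by positivity, by linarith⟩
  let μ : Measure E := volume
  have hφc : HasCompactSupport (φ.normed μ) := φ.hasCompactSupport_normed
  have hint : ∀ x, Integrable (fun t => φ.normed μ t * f (x - t)) μ := fun x =>
    (φ.continuous_normed.mul (hf.continuous.comp (by fun_prop))).integrable_of_hasCompactSupport
      hφc.mul_right
  refine ⟨φ.normed μ ⋆[ContinuousLinearMap.lsmul ℝ ℝ, μ] f,
    hφc.contDiff_convolution_left _ (φ.contDiff_normed (n := 1))
      hf.continuous.locallyIntegrable, ?_, fun x => ?_⟩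
  · refine LipschitzWith.of_dist_le_mul fun x y => ?_
    simp only [MeasureTheory.convolution, ContinuousLinearMap.lsmul_apply, smul_eq_mul]
    rw [dist_eq_norm, ← integral_sub (hint x) (hint y)]
    refine (norm_integral_le_of_norm_le (φ.integrable_normed.mul_const (K * dist x y))
      (ae_of_all _ fun t => ?_)).trans (le_of_eq ?_)
    · rw [← mul_sub, norm_mul, Real.norm_of_nonneg (φ.nonneg_normed t)]
      refine mul_le_mul_of_nonneg_left ?_ (φ.nonneg_normed t)
      simpa [dist_eq_norm] using hf.dist_le_mul (x - t) (y - t)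
    · rw [integral_mul_const, φ.integral_normed, one_mul]
  · refine φ.dist_normed_convolution_le hf.continuous.aestronglyMeasurable fun y hy => ?_
    refine (hf.dist_le_mul y x).trans ?_
    gcongr
    exact (Metric.mem_ball.1 hy).le

end Mollification

theorem tendsto_variance_of_dist_le {Ω : Type*} [MeasurableSpace Ω] {P : Measure Ω}
    [IsProbabilityMeasure P] {X : Ω → ℝ} {Y : ℕ → Ω → ℝ} (hX : MemLp X 2 P)
    (hY : ∀ k, MemLp (Y k) 2 P) {δ : ℕ → ℝ} (hδ : Tendsto δ atTop (𝓝 0)) {M : ℝ}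
    (hM : ∀ k, δ k ≤ M) (h : ∀ k ω, |Y k ω - X ω| ≤ δ k) :
    Tendsto (fun k => Var[Y k; P]) atTop (𝓝 Var[X; P]) := by
  have hlim : ∀ ω, Tendsto (fun k => Y k ω) atTop (𝓝 (X ω)) := fun ω =>
    tendsto_iff_dist_tendsto_zero.2 (squeeze_zero (fun _ => dist_nonneg) (fun k => h k ω) hδ)
  have hb : ∀ k ω, |Y k ω| ≤ |X ω| + M := fun k ω => by
    have := abs_sub_abs_le_abs_sub (Y k ω) (X ω)
    linarith [h k ω, hM k]
  have hbL : MemLp (fun ω => |X ω| + M) 2 P := hX.abs.add (memLp_const M)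
  have t1 : Tendsto (fun k => ∫ ω, Y k ω ∂P) atTop (𝓝 (∫ ω, X ω ∂P)) :=
    tendsto_integral_of_dominated_convergence _ (fun k => (hY k).1)
      (hbL.integrable one_le_two) (fun k => ae_of_all _ (hb k)) (ae_of_all _ hlim)
  have t2 : Tendsto (fun k => ∫ ω, Y k ω ^ 2 ∂P) atTop (𝓝 (∫ ω, X ω ^ 2 ∂P)) := by
    refine tendsto_integral_of_dominated_convergence _ (fun k => (hY k).1.pow 2)
      hbL.integrable_sq (fun k => ae_of_all _ fun ω => ?_)
      (ae_of_all _ fun ω => (hlim ω).pow 2)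
    rw [norm_pow, Real.norm_eq_abs]
    exact pow_le_pow_left₀ (abs_nonneg _) (hb k ω) 2
  have e : ∀ k, Var[Y k; P] = ∫ ω, Y k ω ^ 2 ∂P - (∫ ω, Y k ω ∂P) ^ 2 := fun k =>
    variance_eq_sub (hY k)
  simp only [e]
  rw [variance_eq_sub hX]
  exact t2.sub (t1.pow 2)

/-! ### Partial derivatives on Euclidean space -/

section EuclideanGradient

variable {m : ℕ} {g : EuclideanSpace ℝ (Fin m) → ℝ}

theorem hasDerivAt_comp_toLp_update (hg : Differentiable ℝ g) (x : Fin m → ℝ) (i : Fin m) :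
    HasDerivAt (fun t => g (WithLp.toLp 2 (Function.update x i t)))
      (fderiv ℝ g (WithLp.toLp 2 x) (EuclideanSpace.single i 1)) (x i) := by
  have h1 : HasDerivAt (fun t => WithLp.toLp 2 (Function.update x i t))
      (EuclideanSpace.single i (1 : ℝ)) (x i) := by
    have h := (EuclideanSpace.equiv (Fin m) ℝ).symm.hasFDerivAt.comp_hasDerivAt (x i)
      (hasDerivAt_update x i (x i))
    exact h
  have h2 : HasFDerivAt g (fderiv ℝ g (WithLp.toLp 2 x))
      (WithLp.toLp 2 (Function.update x i (x i))) := by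
    rw [Function.update_eq_self]
    exact (hg _).hasFDerivAt
  exact h2.comp_hasDerivAt (x i) h1

theorem sum_fderiv_single_sq_le {K : ℝ≥0} (hK : LipschitzWith K g)
    (x : EuclideanSpace ℝ (Fin m)) :
    ∑ i, fderiv ℝ g x (EuclideanSpace.single i 1) ^ 2 ≤ (K : ℝ) ^ 2 := by
  set v := (InnerProductSpace.toDual ℝ _).symm (fderiv ℝ g x) with hv
  have h1 : ∀ i, fderiv ℝ g x (EuclideanSpace.single i 1) = v i := fun i => by
    rw [← InnerProductSpace.toDual_symm_apply (y := fderiv ℝ g x), ← hv,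
      EuclideanSpace.inner_single_right]
    simp
  simp only [h1]
  rw [← EuclideanSpace.real_norm_sq_eq, hv, LinearIsometryEquiv.norm_map]
  gcongr
  exact norm_fderiv_le_of_lipschitz ℝ hK

end EuclideanGradient

/-! ### Variance of Lipschitz functions of independent Pareto variables -/

section ParetoLipschitz

variable {lam : ℝ}

/-- Split `x i ^ 2` at the level `s ^ 2`: the bounded part uses the bound on the sum of `D i ^ 2`,
the excess only the bound on each term. -/
theorem sum_sq_mul_sq_le {ι : Type*} [Fintype ι] {D : ι → ℝ} {K : ℝ}
    (hD : ∑ i, D i ^ 2 ≤ K ^ 2) (x : ι → ℝ) (s : ℝ) :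
    ∑ i, x i ^ 2 * D i ^ 2 ≤ K ^ 2 * (s ^ 2 + ∑ i, max (x i ^ 2 - s ^ 2) 0) := by
  have h1 : ∀ i, D i ^ 2 ≤ K ^ 2 := fun i =>
    (Finset.single_le_sum (f := fun i => D i ^ 2) (fun j _ => sq_nonneg _)
      (Finset.mem_univ i)).trans hD
  calc ∑ i, x i ^ 2 * D i ^ 2
      ≤ ∑ i, (s ^ 2 * D i ^ 2 + K ^ 2 * max (x i ^ 2 - s ^ 2) 0) := by
        refine Finset.sum_le_sum fun i _ => ?_
        have h2 := le_max_left (x i ^ 2 - s ^ 2) 0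
        have h3 := le_max_right (x i ^ 2 - s ^ 2) 0
        nlinarith [mul_le_mul_of_nonneg_right (h1 i) h3,
          mul_le_mul_of_nonneg_right h2 (sq_nonneg (D i))]
    _ = s ^ 2 * ∑ i, D i ^ 2 + K ^ 2 * ∑ i, max (x i ^ 2 - s ^ 2) 0 := by
        rw [Finset.sum_add_distrib, ← Finset.mul_sum, ← Finset.mul_sum]
    _ ≤ _ := by nlinarith [mul_le_mul_of_nonneg_left hD (sq_nonneg s)]

/-- Any constant will do: the tensorized bound does not depend on the sup-norm Lipschitz constant.
-/
theorem lipschitzWith_toLp_fin (m : ℕ) :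
    ∃ K : ℝ≥0, LipschitzWith K (fun x : Fin m → ℝ => (WithLp.toLp 2 x : EuclideanSpace ℝ (Fin m))) :=
  ⟨_, ((EuclideanSpace.equiv (Fin m) ℝ).symm : (Fin m → ℝ) →L[ℝ] EuclideanSpace ℝ (Fin m)).lipschitz⟩

theorem memLp_two_pi_paretoLaw_comp_toLp (hlam : 3 < lam) {m : ℕ}
    {f : EuclideanSpace ℝ (Fin m) → ℝ} {K : ℝ≥0} (hf : LipschitzWith K f) :
    MemLp (fun x : Fin m → ℝ => f (WithLp.toLp 2 x)) 2 (Measure.pi fun _ => paretoLaw lam) := by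
  have hP := isProbabilityMeasure_paretoLaw (lam := lam) (by linarith)
  refine LipschitzWith.memLp_comp (memLp_piLp_iff.2 fun i => ?_) hf
  exact memLp_pi_eval (memLp_two_id_paretoLaw hlam) i

theorem variance_pi_paretoLaw_le_of_contDiff (hlam : 3 < lam) {m : ℕ} (hm : 1 ≤ m)
    {g : EuclideanSpace ℝ (Fin m) → ℝ} {K : ℝ≥0} (hgc : ContDiff ℝ 1 g)
    (hg : LipschitzWith K g) :
    Var[fun x : Fin m → ℝ => g (WithLp.toLp 2 x); Measure.pi fun _ => paretoLaw lam]
      ≤ 4 / ((lam - 1) * (lam - 3)) * (K : ℝ) ^ 2 * (m : ℝ) ^ (2 / (lam - 1)) := by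
  have hP := isProbabilityMeasure_paretoLaw (lam := lam) (by linarith)
  have hid := memLp_two_id_paretoLaw hlam
  obtain ⟨L, hL⟩ := lipschitzWith_toLp_fin m
  let D : (Fin m → ℝ) → Fin m → ℝ := fun x i =>
    fderiv ℝ g (WithLp.toLp 2 x) (EuclideanSpace.single i 1)
  have hDc : ∀ i, Continuous fun x => D x i := fun i =>
    ((hgc.continuous_fderiv one_ne_zero).comp hL.continuous).clm_apply continuous_const
  have hDK : ∀ x, ∑ i, D x i ^ 2 ≤ (K : ℝ) ^ 2 := fun x => sum_fderiv_single_sq_le hg _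
  have hDK' : ∀ i x, |D x i| ≤ K := fun i x =>
    abs_le_of_sq_le_sq ((Finset.single_le_sum (f := fun i => D x i ^ 2)
      (fun j _ => sq_nonneg _) (Finset.mem_univ i)).trans (hDK x)) K.2
  have hV := variance_pi_le_sum_integral hid
    (fun g g' K h1 h2 h3 => variance_paretoLaw_le hlam h1 h2 h3) m
    (fun x => g (WithLp.toLp 2 x)) D (K * L) (hg.comp hL) hDc
    fun x i => hasDerivAt_comp_toLp_update (hgc.differentiable one_ne_zero) x i
  refine hV.trans ?_
  set c : ℝ := 4 / (lam - 1) ^ 2 with hc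
  have hm0 : (1 : ℝ) ≤ m := by exact_mod_cast hm
  have hl1 : 0 < lam - 1 := by linarith
  have hl3 : 0 < lam - 3 := by linarith
  -- This level balances the two contributions: `m * s ^ (3 - lam) = s ^ 2`.
  set s : ℝ := (m : ℝ) ^ (1 / (lam - 1)) with hs
  have hs1 : 1 ≤ s := Real.one_le_rpow hm0 (by positivity)
  have hs2 : s ^ 2 = (m : ℝ) ^ (2 / (lam - 1)) := by
    rw [hs, ← Real.rpow_natCast, ← Real.rpow_mul (by linarith)]
    congr 1
    push_cast
    ring
  have hsm : m * s ^ (3 - lam) = s ^ 2 := by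
    have : (m : ℝ) = s ^ (lam - 1) := by
      rw [hs, ← Real.rpow_mul (by linarith), one_div, inv_mul_cancel₀ hl1.ne', Real.rpow_one]
    rw [this, ← Real.rpow_add (by linarith), ← Real.rpow_two]
    congr 1
    ring
  have hI : ∀ i, Integrable (fun x : Fin m → ℝ => c * (x i ^ 2 * D x i ^ 2))
      (Measure.pi fun _ => paretoLaw lam) :=
    fun i => integrable_sq_mul_sq_pi hid (hDc i) (hDK' i) c i
  have hmax : Integrable (fun x : ℝ => max (x ^ 2 - s ^ 2) 0) (paretoLaw lam) :=
    (hid.integrable_sq.sub (integrable_const _)).pos_part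
  have hJ : ∀ i : Fin m, Integrable (fun x : Fin m → ℝ => max (x i ^ 2 - s ^ 2) 0)
      (Measure.pi fun _ => paretoLaw lam) := fun i =>
    (measurePreserving_eval (fun _ : Fin m => paretoLaw lam) i).integrable_comp_of_integrable hmax
  have hJI : ∀ i : Fin m, ∫ x : Fin m → ℝ, max (x i ^ 2 - s ^ 2) 0
      ∂(Measure.pi fun _ => paretoLaw lam) = 2 / (lam - 3) * s ^ (3 - lam) := fun i => by
    have hmp := measurePreserving_eval (fun _ : Fin m => paretoLaw lam) i
    have h := integral_map (f := fun x : ℝ => max (x ^ 2 - s ^ 2) 0)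
      hmp.aemeasurable (by fun_prop)
    rw [hmp.map_eq, integral_max_sq_sub_paretoLaw hlam hs1] at h
    exact h.symm
  have hJs : Integrable (fun x : Fin m → ℝ => s ^ 2 + ∑ i, max (x i ^ 2 - s ^ 2) 0)
      (Measure.pi fun _ => paretoLaw lam) :=
    (integrable_const _).add (integrable_finsetSum _ fun i _ => hJ i)
  rw [← integral_finsetSum _ fun i _ => hI i]
  calc ∫ x, ∑ i, c * (x i ^ 2 * D x i ^ 2) ∂(Measure.pi fun _ => paretoLaw lam)
      ≤ ∫ x, c * (K : ℝ) ^ 2 * (s ^ 2 + ∑ i, max (x i ^ 2 - s ^ 2) 0)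
          ∂(Measure.pi fun _ => paretoLaw lam) := by
        refine integral_mono (integrable_finsetSum _ fun i _ => hI i) (hJs.const_mul _)
          fun x => ?_
        simp only
        rw [← Finset.mul_sum, mul_assoc]
        exact mul_le_mul_of_nonneg_left (sum_sq_mul_sq_le (hDK x) x s) (by positivity)
    _ = c * (K : ℝ) ^ 2 * (s ^ 2 + 2 / (lam - 3) * (m * s ^ (3 - lam))) := by
        rw [integral_const_mul, integral_add (integrable_const _)
          (integrable_finsetSum _ fun i _ => hJ i), integral_finsetSum _ fun i _ => hJ i]
        simp only [hJI, integral_const, probReal_univ, one_smul, Finset.sum_const,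
          Finset.card_univ, Fintype.card_fin, nsmul_eq_mul]
        ring
    -- Uses `1 + 2 / (lam - 3) = (lam - 1) / (lam - 3)`.
    _ = _ := by
        rw [hsm, ← hs2, hc]
        field_simp
        ring

theorem variance_pi_paretoLaw_le (hlam : 3 < lam) {m : ℕ} (hm : 1 ≤ m)
    {f : EuclideanSpace ℝ (Fin m) → ℝ} {K : ℝ≥0} (hf : LipschitzWith K f) :
    Var[fun x : Fin m → ℝ => f (WithLp.toLp 2 x); Measure.pi fun _ => paretoLaw lam]
      ≤ 4 / ((lam - 1) * (lam - 3)) * (K : ℝ) ^ 2 * (m : ℝ) ^ (2 / (lam - 1)) := by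
  have hP := isProbabilityMeasure_paretoLaw (lam := lam) (by linarith)
  choose g hgc hg hgf using fun k : ℕ =>
    hf.exists_contDiff_dist_le (ε := 1 / ((k : ℝ) + 1)) (by positivity)
  refine le_of_tendsto' (tendsto_variance_of_dist_le (δ := fun k => K * (1 / ((k : ℝ) + 1)))
    (Y := fun k (x : Fin m → ℝ) => g k (WithLp.toLp 2 x)) (M := K)
    (memLp_two_pi_paretoLaw_comp_toLp hlam hf)
    (fun k => memLp_two_pi_paretoLaw_comp_toLp hlam (hg k)) ?_ (fun k => ?_)
    fun k x => hgf k _) fun k => variance_pi_paretoLaw_le_of_contDiff hlam hm (hgc k) (hg k)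
  · simpa using (tendsto_one_div_add_atTop_nhds_zero_nat (𝕜 := ℝ)).const_mul (K : ℝ)
  · refine mul_le_of_le_one_right K.2 ?_
    rw [div_le_one (by positivity)]
    linarith [(Nat.cast_nonneg k : (0 : ℝ) ≤ k)]

/-- Variance bound for Lipschitz functions of independent Pareto variables. -/
theorem variance_lipschitz_pareto_le {Ω ι : Type*} [MeasurableSpace Ω] {P : Measure Ω}
    [IsProbabilityMeasure P] [Fintype ι] [Nonempty ι] (hlam : 3 < lam) {X : ι → Ω → ℝ}
    (hindep : iIndepFun X P) (hlaw : ∀ i, HasLaw (X i) (paretoLaw lam) P)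
    {f : EuclideanSpace ℝ ι → ℝ} {K : ℝ≥0} (hf : LipschitzWith K f) :
    MemLp (fun ω => f (WithLp.toLp 2 fun i => X i ω)) 2 P ∧
    Var[fun ω => f (WithLp.toLp 2 fun i => X i ω); P]
      ≤ 4 / ((lam - 1) * (lam - 3)) * (K : ℝ) ^ 2
        * (Fintype.card ι : ℝ) ^ (2 / (lam - 1)) := by
  have hP := isProbabilityMeasure_paretoLaw (lam := lam) (by linarith)
  -- The product bound was proved by induction over `Fin m`, so the index set is enumerated;
  -- permuting coordinates is an isometry.
  let e := Fintype.equivFin ι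
  have hY : iIndepFun (fun k ω => X (e.symm k) ω) P := hindep.precomp e.symm.injective
  have hmeas : ∀ k, AEMeasurable (fun ω => X (e.symm k) ω) P := fun k =>
    (hlaw (e.symm k)).aemeasurable
  have hmap := hY.map_fun_eq_pi_map hmeas
  simp only [fun k => (hlaw (e.symm k)).map_eq] at hmap
  set Y : Ω → Fin (Fintype.card ι) → ℝ := fun ω k => X (e.symm k) ω with hYdef
  have hYm : AEMeasurable Y P := aemeasurable_pi_lambda _ hmeas
  let φ := LinearIsometryEquiv.piLpCongrLeft 2 ℝ ℝ e.symm
  have hfφ : LipschitzWith K (fun y => f (φ y)) := by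
    simpa [Function.comp_def] using hf.comp φ.lipschitz
  have hcomp : (fun ω => f (WithLp.toLp 2 fun i => X i ω))
      = fun ω => f (φ (WithLp.toLp 2 (Y ω))) := by
    funext ω
    congr 1
    ext i
    simp [φ, Y, LinearIsometryEquiv.piLpCongrLeft_apply, Equiv.piCongrLeft']
  have hL := memLp_two_pi_paretoLaw_comp_toLp hlam hfφ
  have hV := variance_pi_paretoLaw_le hlam Fintype.card_pos hfφ
  rw [← hmap] at hL hV
  rw [hcomp]
  refine ⟨(memLp_map_measure_iff hL.1 hYm).1 hL, ?_⟩
  rwa [variance_map hL.1.aemeasurable hYm] at hV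

end ParetoLipschitz

/-! ### Comparison of the constants -/

section Constant

/-- Logarithmic form of `eight_mul_le_two_mul_paretoConst`, with `a = lam - 1`. The term `-4 log 2`
dominates; the delicate range is `a` near `2`, where `log (a - 2)` is negative. -/
theorem log_inequality {a : ℝ} (ha : 2 < a) :
    (6 / a - 4) * Real.log 2 + 2 / a * Real.log 3 + (a - 5) / (a + 1) * Real.log a
      - (a - 2) / a * Real.log (a - 2) ≤ 0 := by
  have ha0 : 0 < a := by linarith
  have hL2 : 0.6931471803 < Real.log 2 := Real.log_two_gt_d9
  -- From `3 ^ 5 = 243 ≤ 256 = 2 ^ 8`.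
  have hL3 : Real.log 3 ≤ 8 / 5 * Real.log 2 := by
    have h : Real.log ((3 : ℝ) ^ 5) ≤ Real.log ((2 : ℝ) ^ 8) :=
      Real.log_le_log (by norm_num) (by norm_num)
    rw [Real.log_pow, Real.log_pow] at h
    push_cast at h
    linarith
  have hLa : Real.log 2 ≤ Real.log a := Real.log_le_log (by norm_num) ha.le
  suffices h : (6 - 4 * a) * Real.log 2 + 2 * Real.log 3
      + a * (a - 5) / (a + 1) * Real.log a - (a - 2) * Real.log (a - 2) ≤ 0 by
    have e : (6 / a - 4) * Real.log 2 + 2 / a * Real.log 3 + (a - 5) / (a + 1) * Real.log a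
        - (a - 2) / a * Real.log (a - 2) = ((6 - 4 * a) * Real.log 2 + 2 * Real.log 3
      + a * (a - 5) / (a + 1) * Real.log a - (a - 2) * Real.log (a - 2)) / a := by
      field_simp
    rw [e]
    exact div_nonpos_of_nonpos_of_nonneg h ha0.le
  rcases le_total a 5 with h5 | h5
  · have hcoef : a * (a - 5) / (a + 1) ≤ 0 :=
      div_nonpos_of_nonpos_of_nonneg (by nlinarith) (by linarith)
    have h1 : a * (a - 5) / (a + 1) * Real.log a ≤ a * (a - 5) / (a + 1) * Real.log 2 :=
      mul_le_mul_of_nonpos_left hLa hcoef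
    rcases le_total a 3 with h3 | h3
    · have hx : 0 < a - 2 := by linarith
      have h2 : -((a - 2) * Real.log (a - 2)) ≤ 1 / 2 := by
        -- The factor `2` gives the bound `1/2` on `-t log t`, `t = a - 2`; without it the bound
        -- would be `1`, too weak against `4/5 · log 2 ≈ 0.55`.
        have h := Real.log_le_sub_one_of_pos (x := 1 / (2 * (a - 2))) (by positivity)
        rw [one_div, Real.log_inv, Real.log_mul two_ne_zero hx.ne'] at h
        have h' := mul_le_mul_of_nonneg_left h hx.le
        have e : (a - 2) * ((2 * (a - 2))⁻¹ - 1) = 1 / 2 - (a - 2) := by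
          field_simp
        rw [e] at h'
        have h2' := Real.log_two_lt_d9
        nlinarith
      have h4 : 6 - 4 * a + 16 / 5 + a * (a - 5) / (a + 1) ≤ -(4 / 5) := by
        rw [← le_sub_iff_add_le', div_le_iff₀ (by linarith)]
        nlinarith
      nlinarith [mul_le_mul_of_nonneg_right h4 (by linarith : 0 ≤ Real.log 2)]
    · have h2 : 0 ≤ (a - 2) * Real.log (a - 2) :=
        mul_nonneg (by linarith) (Real.log_nonneg (by linarith))
      have h4 : a * (a - 5) / (a + 1) * Real.log 2 ≤ 0 :=
        mul_nonpos_of_nonpos_of_nonneg hcoef (by linarith)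
      nlinarith
  · have hx : 0 < a - 2 := by linarith
    have h1 : a * (a - 5) / (a + 1) * Real.log a ≤ (a - 2) * Real.log a := by
      refine mul_le_mul_of_nonneg_right ?_ (by linarith)
      rw [div_le_iff₀ (by linarith)]
      nlinarith
    have h2 : (a - 2) * (Real.log a - Real.log (a - 2)) ≤ 2 := by
      rw [← Real.log_div ha0.ne' hx.ne']
      have h := Real.log_le_sub_one_of_pos (x := a / (a - 2)) (by positivity)
      calc (a - 2) * Real.log (a / (a - 2)) ≤ (a - 2) * (a / (a - 2) - 1) := by gcongr
        _ = 2 := by field_simp; ring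
    nlinarith

theorem eight_mul_le_two_mul_paretoConst {lam : ℝ} (hlam : 3 < lam) :
    8 / ((lam - 1) * (lam - 3)) * 3 ^ (2 / (lam - 1)) ≤ 2 * paretoConst lam := by
  have h1 : 0 < lam - 1 := by linarith
  have h3 : 0 < lam - 3 := by linarith
  have h0 : 0 < lam := by linarith
  have hlog := log_inequality (a := lam - 1) (by linarith)
  have e3 : lam - 1 - 2 = lam - 3 := by ring
  have e0 : lam - 1 + 1 = lam := by ring
  rw [e3, e0] at hlog
  rw [paretoConst, ← Real.log_le_log_iff (by positivity) (by positivity)]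
  have l8 : Real.log 8 = 3 * Real.log 2 := by
    rw [show (8 : ℝ) = 2 ^ 3 by norm_num, Real.log_pow]; norm_num
  have l4 : Real.log 4 = 2 * Real.log 2 := by
    rw [show (4 : ℝ) = 2 ^ 2 by norm_num, Real.log_pow]; norm_num
  have p1 : (2 : ℝ) ^ ((6 * lam - 16) / (lam - 1)) ≠ 0 := by positivity
  have p2 : (lam - 1) ^ (-((2 * lam - 6) / lam)) ≠ 0 := by positivity
  have p3 : (4 / (lam - 3)) ^ (2 / (lam - 1)) ≠ 0 := by positivity
  rw [Real.log_mul (by positivity) (by positivity), Real.log_div (by norm_num) (by positivity),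
    Real.log_mul h1.ne' h3.ne', Real.log_rpow (by norm_num), l8,
    Real.log_mul two_ne_zero (mul_ne_zero (mul_ne_zero p1 p2) p3),
    Real.log_mul (mul_ne_zero p1 p2) p3, Real.log_mul p1 p2, Real.log_rpow two_pos,
    Real.log_rpow h1, Real.log_rpow (by positivity), Real.log_div (by norm_num) h3.ne', l4]
  rw [← sub_nonpos]
  refine (le_of_eq ?_).trans hlog
  field_simp
  ring

/-- The count is `n(n+1)/2`; the factor `3` is sharp at `n = 2`. -/
theorem card_upper_le {n : ℕ} (hn : 2 ≤ n) :
    (Fintype.card {p : Fin n × Fin n // p.1 ≤ p.2} : ℝ) ≤ 3 * ((n : ℝ) * ((n : ℝ) - 1) / 2) := by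
  rw [← Fintype.card_congr Sym2.sortEquiv, Sym2.card, Fintype.card_fin, Nat.cast_choose_two]
  have : (2 : ℝ) ≤ n := by exact_mod_cast hn
  push_cast
  nlinarith

end Constant

end Auxiliary

/-! ### The variance bound for eigenvalues -/

theorem mainTheorem7 {Ω : Type*} [MeasurableSpace Ω] (P : Measure Ω) [IsProbabilityMeasure P]
    (lam : ℝ) (hlam : 3 < lam) (n : ℕ) (hn : 2 ≤ n)
    (A : Ω → Matrix (Fin n) (Fin n) ℝ) (hsymm : ∀ ω, (A ω).IsSymm)
    (hindep : iIndepFun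
      (fun (e : {p : Fin n × Fin n // p.1 ≤ p.2}) (ω : Ω) => A ω e.1.1 e.1.2) P)
    (hlaw : ∀ i j : Fin n, i ≤ j → HasLaw (fun ω => A ω i j) (paretoLaw lam) P)
    (i : Fin n) :
    MemLp (fun ω => orderedEigenvalue (A ω) (hsymm ω) i) 2 P ∧
    variance (fun ω => orderedEigenvalue (A ω) (hsymm ω) i) P ≤
      2 * paretoConst lam * ((n : ℝ) * ((n : ℝ) - 1) / 2) ^ (2 / (lam - 1)) := by
  have : NeZero n := ⟨by omega⟩
  have : Nonempty {p : Fin n × Fin n // p.1 ≤ p.2} := ⟨⟨(0, 0), le_rfl⟩⟩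
  obtain ⟨hL, hV⟩ := variance_lipschitz_pareto_le hlam hindep (fun e => hlaw _ _ e.2)
    (lipschitzWith_orderedEigenvalue_symmetricOfUpper i)
  simp only [fun ω => symmetricOfUpper_entries (hsymm ω)] at hL hV
  refine ⟨hL, hV.trans ?_⟩
  have h1 : 0 < lam - 1 := by linarith
  have h3 : 0 < lam - 3 := by linarith
  have hn' : (2 : ℝ) ≤ n := by exact_mod_cast hn
  have hN : 0 ≤ (n : ℝ) * ((n : ℝ) - 1) / 2 := by
    have := mul_nonneg (Nat.cast_nonneg n : (0 : ℝ) ≤ n) (by linarith : 0 ≤ (n : ℝ) - 1)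
    linarith
  have hsq : ((NNReal.sqrt 2 : NNReal) : ℝ) ^ 2 = 2 := by
    rw [Real.coe_sqrt]; exact Real.sq_sqrt (by simp)
  rw [hsq]
  calc 4 / ((lam - 1) * (lam - 3)) * 2
        * (Fintype.card {p : Fin n × Fin n // p.1 ≤ p.2} : ℝ) ^ (2 / (lam - 1))
      ≤ 4 / ((lam - 1) * (lam - 3)) * 2
        * (3 * ((n : ℝ) * ((n : ℝ) - 1) / 2)) ^ (2 / (lam - 1)) := by
        gcongr
        exact card_upper_le hn
    _ = 8 / ((lam - 1) * (lam - 3)) * 3 ^ (2 / (lam - 1))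
        * ((n : ℝ) * ((n : ℝ) - 1) / 2) ^ (2 / (lam - 1)) := by
        rw [Real.mul_rpow (by norm_num) hN]
        ring
    _ ≤ _ := mul_le_mul_of_nonneg_right (eight_mul_le_two_mul_paretoConst hlam)
        (Real.rpow_nonneg hN _)
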